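/- Let $K$ be a field, let $1\le d\le n$ be integers, let $S=K[x_1,\ldots,x_n]$, and let $I_{n,d}\subset S$ be the ideal generated by all square free monomials of degree $d$. For a $\mathbb Z^n$-graded $S$-module $M$, a Stanley decomposition of $M$ is a finite direct sum decomposition $\mathcal D: M=\bigoplus_{i=1}^r m_iK[Z_i]$ as a $K$-vector space, where each $m_i\in M$ is homogeneous, $Z_i\subset\{x_1,\ldots,x_n\}$, and $m_iK[Z_i]$ is a free $K[Z_i]$-module with basis $m_i$. Put $\operatorname{sdepth}(\mathcal D)=\min_i|Z_i|$, and let $\operatorname{sdepth}(M)$ be the maximum of $\operatorname{sdepth}(\mathcal D)$ over all Stanley decompositions $\mathcal D$ of $M$. For a nonzero finitely generated graded $S$-module $M$, let $\operatorname{depth}(M)$ be the maximal length of an $M$-regular sequence contained in $(x_1,\ldots,x_n)$. Then $S/I_{n,d}$ and $I_{n,d}$ satisfy Stanley's conjecture, that is, $$\operatorname{sdepth}(S/I_{n,d})\ge\operatorname{depth}(S/I_{n,d}),\qquad \operatorname{sdepth}(I_{n,d})\ge\operatorname{depth}(I_{n,d}).$$ Here $\operatorname{depth}(S/I_{n,d})=\dim(S/I_{n,d})=d-1$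 (so $S/I_{n,d}$ is Cohen–Macaulay) and $\operatorname{depth}(I_{n,d})=d$. Moreover, $$\operatorname{sdepth}(I_{n,d})\ge\operatorname{sdepth}(S/I_{n,d})+1.$$ -/

import Mathlib

open MvPolynomial

/-- The square free Veronese ideal `I_{n,d}` of `K[x_1, …, x_n]`: it is generated by the square free
monomials of degree `d`, i.e. by the products of `d` distinct variables. -/
noncomputable def sqfreeVeronese (K : Type*) [Field K] (n d : ℕ) : Ideal (MvPolynomial (Fin n) K) :=
  Ideal.span {u | ∃ F : Finset (Fin n), F.card = d ∧ u = ∏ i ∈ F, X i}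

/-- The component of multidegree `a ∈ ℤⁿ` of `K[x_1, …, x_n]`: spanned by the monomial with
exponent vector `a` if `a` has nonnegative entries, and zero otherwise. -/
noncomputable def multidegComponent (K : Type*) [Field K] (n : ℕ) (a : Fin n → ℤ) :
    Submodule K (MvPolynomial (Fin n) K) :=
  Submodule.span K {u | ∃ s : Fin n →₀ ℕ, (∀ i, (s i : ℤ) = a i) ∧ u = monomial s 1}

/-- The components `I ∩ S_a` of the `ℤⁿ`-grading of a monomial ideal `I` of `S`. -/
noncomputable def idealGrading {K : Type*} [Field K] {n : ℕ} (I : Ideal (MvPolynomial (Fin n) K))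
    (a : Fin n → ℤ) : Submodule K I :=
  (multidegComponent K n a).comap (I.subtype.restrictScalars K)

/-- The components (images of the `S_a`) of the `ℤⁿ`-grading of `S/I`, for a monomial ideal `I`. -/
noncomputable def quotientGrading {K : Type*} [Field K] {n : ℕ}
    (I : Ideal (MvPolynomial (Fin n) K)) (a : Fin n → ℤ) :
    Submodule K (MvPolynomial (Fin n) K ⧸ I) :=
  (multidegComponent K n a).map (I.mkQ.restrictScalars K)

section StanleyDepth

variable {K : Type*} [Field K] {n : ℕ} {M : Type*} [AddCommGroup M] [Module K M]
  [Module (MvPolynomial (Fin n) K) M] [IsScalarTower K (MvPolynomial (Fin n) K) M]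

/-- The Stanley space `m K[Z] ⊆ M`, as a `K`-subspace: all `p • m` where the polynomial `p` involves
only variables from `Z`. -/
noncomputable def stanleySpace (m : M) (Z : Finset (Fin n)) : Submodule K M :=
  (Subalgebra.toSubmodule (supported K (Z : Set (Fin n)))).map
    ((LinearMap.toSpanSingleton (MvPolynomial (Fin n) K) M m).restrictScalars K)

/-- `M = ⨁ᵢ mᵢ K[Zᵢ]` is a Stanley decomposition of the `ℤⁿ`-graded module `M` with graded
components `𝒢 a`: the `mᵢ` are homogeneous, each `mᵢ K[Zᵢ]` is a free `K[Zᵢ]`-module with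
basis `mᵢ`, and `M` is the direct sum of these subspaces over `K`. -/
structure IsStanleyDecomposition (𝒢 : (Fin n → ℤ) → Submodule K M) {r : ℕ}
    (m : Fin r → M) (Z : Fin r → Finset (Fin n)) : Prop where
  homogeneous : ∀ i, ∃ a, m i ∈ 𝒢 a
  free : ∀ i, ∀ p ∈ supported K (Z i : Set (Fin n)), p • m i = 0 → p = 0
  isInternal : DirectSum.IsInternal fun i => stanleySpace (K := K) (m i) (Z i)

/-- The Stanley depth of a `ℤⁿ`-graded module with graded components `𝒢 a`: the maximum, over all
Stanley decompositions, of the minimum of the `|Zᵢ|`. -/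
noncomputable def sdepth (𝒢 : (Fin n → ℤ) → Submodule K M) : ℕ∞ :=
  sSup {k | ∃ (r : ℕ) (m : Fin r → M) (Z : Fin r → Finset (Fin n)),
    IsStanleyDecomposition 𝒢 m Z ∧ k = ⨅ i, ((Z i).card : ℕ∞)}

end StanleyDepth

/-- The depth of a (nonzero finitely generated multigraded) module `M` over `K[x_1, …, x_n]`: the
maximal length of an `M`-regular sequence contained in `(x_1, …, x_n)`. -/
noncomputable def polyDepth (K : Type*) [Field K] (n : ℕ) (M : Type*) [AddCommGroup M]
    [Module (MvPolynomial (Fin n) K) M] : ℕ∞ :=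
  sSup {k | ∃ rs : List (MvPolynomial (Fin n) K),
    (∀ f ∈ rs, f ∈ idealOfVars (Fin n) K) ∧
    RingTheory.Sequence.IsRegular M rs ∧ k = rs.length}

/-! Depth is computed as the least `i` with `Extⁱ(K, M) ≠ 0`, where `K = S/(x₁,…,xₙ)`. To run an
induction, `I_{n,d}` is enlarged to the family `J = I_{V,d} + (xᵢ : i ∈ G)` with `V`, `G` disjoint.
For `y ∈ V`, the ideals `J : y` and `J + (y)` again belong to the family with `y` removed from `V`,
and the expected depth `d - 1 + n - |V| - |G|` is the same for all three. The sequence `0 → S/(J :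
y) → S/J → S/(J + (y)) → 0` then carries the depth, down to quotients by variables
(`isExtDepth_veronese`). The depth of `I_{n,d}` follows from `0 → I → S → S/I → 0`, since `depth S =
n ≥ d`.

For Stanley depth, intervals `[A, B]` partitioning the possible monomial supports give Stanley
spaces `x_A K[B]` (`isStanleyDecomposition_of_intervals`). For `I` the one-point intervals `[F, F]`,
`|F| ≥ d`, suffice. For `S/I` the supports are the sets of size at most `d - 1`, and a shelling of
this skeleton of the simplex partitions them into intervals with tops of size exactly `d - 1`.
Conversely a product of `d` variables kills `S/I`, so no free summand can have `|Z| ≥ d`. Hence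
`sdepth (S/I) = d - 1`, which yields the final comparison. -/

/-! ### Depth through vanishing of Ext -/

section ExtDepth

open CategoryTheory CategoryTheory.Abelian

universe u

variable {R : Type u} [CommRing R]
variable {X L M N : Type u} [AddCommGroup X] [AddCommGroup L] [AddCommGroup M] [AddCommGroup N]
variable [Module R X] [Module R L] [Module R M] [Module R N]

theorem moduleCat_shortExact (f : L →ₗ[R] M) (g : M →ₗ[R] N) (hf : Function.Injective f)
    (hfg : Function.Exact f g) (hg : Function.Surjective g) :
    (ShortComplex.moduleCatMk f g hfg.linearMap_comp_eq_zero).ShortExact where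
  exact := (ShortComplex.ShortExact.moduleCat_exact_iff_function_exact _).2 hfg
  mono_f := (ModuleCat.mono_iff_injective _).2 hf
  epi_g := (ModuleCat.epi_iff_surjective _).2 hg

/-- `Extⁱ(X, M) = 0`. -/
def ExtVanishes (R : Type u) [CommRing R] (X M : Type u) [AddCommGroup X] [AddCommGroup M]
    [Module R X] [Module R M] (i : ℕ) : Prop :=
  ∀ x : Ext (ModuleCat.of R X) (ModuleCat.of R M) i, x = 0

/-- `k` is the smallest `i` with `Extⁱ(X, M) ≠ 0`. -/
def IsExtDepth (R : Type u) [CommRing R] (X M : Type u) [AddCommGroup X] [AddCommGroup M]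
    [Module R X] [Module R M] (k : ℕ) : Prop :=
  (∀ i < k, ExtVanishes R X M i) ∧ ¬ ExtVanishes R X M k

theorem ExtVanishes.middle {f : L →ₗ[R] M} {g : M →ₗ[R] N} (hf : Function.Injective f)
    (hfg : Function.Exact f g) (hg : Function.Surjective g) {i : ℕ}
    (hL : ExtVanishes R X L i) (hN : ExtVanishes R X N i) : ExtVanishes R X M i := by
  intro x
  have h := moduleCat_shortExact f g hf hfg hg
  obtain ⟨y, rfl⟩ := Ext.covariant_sequence_exact₂ (ModuleCat.of R X) h x (hN _)
  obtain rfl : y = 0 := hL y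
  exact Ext.zero_comp ..

theorem ExtVanishes.left {f : L →ₗ[R] M} {g : M →ₗ[R] N} (hf : Function.Injective f)
    (hfg : Function.Exact f g) (hg : Function.Surjective g) {i : ℕ}
    (hM : ExtVanishes R X M (i + 1)) (hN : ExtVanishes R X N i) : ExtVanishes R X L (i + 1) := by
  intro x
  have h := moduleCat_shortExact f g hf hfg hg
  obtain ⟨y, rfl⟩ := Ext.covariant_sequence_exact₁ (ModuleCat.of R X) h x (hM _) rfl
  obtain rfl : y = 0 := hN y
  exact Ext.zero_comp ..

theorem ExtVanishes.right {f : L →ₗ[R] M} {g : M →ₗ[R] N} (hf : Function.Injective f)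
    (hfg : Function.Exact f g) (hg : Function.Surjective g) {i : ℕ}
    (hM : ExtVanishes R X M i) (hL : ExtVanishes R X L (i + 1)) : ExtVanishes R X N i := by
  intro x
  have h := moduleCat_shortExact f g hf hfg hg
  obtain ⟨y, rfl⟩ := Ext.covariant_sequence_exact₃ (ModuleCat.of R X) h x rfl (hL _)
  obtain rfl : y = 0 := hM y
  exact Ext.zero_comp ..

theorem ExtVanishes.of_linearEquiv (e : L ≃ₗ[R] M) {i : ℕ} (hL : ExtVanishes R X L i) :
    ExtVanishes R X M i := by
  refine ExtVanishes.middle (N := PUnit.{u + 1}) (f := e.toLinearMap) (g := 0) e.injective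
    (fun x ↦ ⟨fun _ ↦ e.surjective x, fun _ ↦ rfl⟩) (fun _ ↦ ⟨0, rfl⟩) hL fun x ↦ ?_
  have : 𝟙 (ModuleCat.of R PUnit.{u + 1}) = 0 := ModuleCat.hom_ext (Subsingleton.elim _ _)
  rw [← Ext.comp_mk₀_id x, this, Ext.mk₀_zero, Ext.comp_zero]

theorem extVanishes_zero_iff : ExtVanishes R X M 0 ↔ Subsingleton (X →ₗ[R] M) := by
  constructor
  · intro h
    refine subsingleton_of_forall_eq 0 fun f ↦ ?_
    have := h (Ext.mk₀ (ModuleCat.ofHom f))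
    rw [Ext.mk₀_eq_zero_iff] at this
    simpa using congrArg ModuleCat.Hom.hom this
  · intro h x
    obtain ⟨f, rfl⟩ := Ext.addEquiv₀.symm.surjective x
    have : f = 0 := ModuleCat.hom_ext (Subsingleton.elim _ _)
    rw [this, map_zero]

theorem ExtVanishes.left_zero {f : L →ₗ[R] M} (hf : Function.Injective f)
    (hM : ExtVanishes R X M 0) : ExtVanishes R X L 0 := by
  rw [extVanishes_zero_iff] at hM ⊢
  refine ⟨fun a b ↦ LinearMap.ext fun x ↦ hf ?_⟩
  exact LinearMap.congr_fun (Subsingleton.elim (f ∘ₗ a) (f ∘ₗ b)) x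

/-- Multiplication by `r` on Ext may be computed in either argument, and on `X` it is zero. -/
theorem comp_mk₀_lsmul_eq_zero {r : R} (hr : r ∈ Module.annihilator R X) {i : ℕ}
    (x : Ext (ModuleCat.of R X) (ModuleCat.of R M) i) :
    x.comp (Ext.mk₀ (ModuleCat.ofHom (LinearMap.lsmul R M r))) (add_zero i) = 0 := by
  have h1 : (ModuleCat.ofHom (LinearMap.lsmul R M r)) = r • 𝟙 (ModuleCat.of R M) := by
    ext; simp
  have h2 : r • 𝟙 (ModuleCat.of R X) = 0 := by
    ext x
    simpa using Module.mem_annihilator.mp hr x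
  have h3 : r • x = (Ext.mk₀ (r • 𝟙 (ModuleCat.of R X))).comp x (zero_add i) := by
    simp [Ext.mk₀_smul]
  rw [h1, ← Ext.smul_eq_comp_mk₀, h3, h2, Ext.mk₀_zero, Ext.zero_comp]

theorem ExtVanishes.succ_of_lsmul {r : R} {g : M →ₗ[R] N} (hr : r ∈ Module.annihilator R X)
    (hf : Function.Injective (LinearMap.lsmul R M r))
    (hfg : Function.Exact (LinearMap.lsmul R M r) g) (hg : Function.Surjective g) {i : ℕ}
    (hN : ExtVanishes R X N i) : ExtVanishes R X M (i + 1) := by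
  intro x
  have h := moduleCat_shortExact _ g hf hfg hg
  obtain ⟨y, rfl⟩ := Ext.covariant_sequence_exact₁ (ModuleCat.of R X) h x
    (comp_mk₀_lsmul_eq_zero hr x) rfl
  obtain rfl : y = 0 := hN y
  exact Ext.zero_comp ..

theorem extVanishes_zero_of_lsmul {r : R} (hr : r ∈ Module.annihilator R X)
    (hf : IsSMulRegular M r) : ExtVanishes R X M 0 :=
  extVanishes_zero_iff.2 (hf.linearMap_subsingleton_of_mem_annihilator hr)

theorem IsExtDepth.of_lsmul {r : R} {g : M →ₗ[R] N} (hr : r ∈ Module.annihilator R X)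
    (hf : Function.Injective (LinearMap.lsmul R M r))
    (hfg : Function.Exact (LinearMap.lsmul R M r) g) (hg : Function.Surjective g) {k : ℕ}
    (hN : IsExtDepth R X N k) : IsExtDepth R X M (k + 1) := by
  have hv : ∀ i < k + 1, ExtVanishes R X M i := by
    rintro (_ | i) hi
    · exact extVanishes_zero_of_lsmul hr hf
    · exact ExtVanishes.succ_of_lsmul hr hf hfg hg (hN.1 i (by omega))
  exact ⟨hv, fun h ↦ hN.2 (ExtVanishes.right hf hfg hg (hv k (by omega)) h)⟩

/-- Vanishing of `Ext^(k-1)(X, N)` makes `Ext^k(X, L) → Ext^k(X, M)` injective, so nonvanishing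
passes to `M`; no information on `Ext^k(X, N)` is needed. -/
theorem IsExtDepth.middle {f : L →ₗ[R] M} {g : M →ₗ[R] N} (hf : Function.Injective f)
    (hfg : Function.Exact f g) (hg : Function.Surjective g) {k : ℕ}
    (hL : IsExtDepth R X L k) (hN : ∀ i < k, ExtVanishes R X N i) : IsExtDepth R X M k := by
  refine ⟨fun i hi ↦ ExtVanishes.middle hf hfg hg (hL.1 i hi) (hN i hi), fun h ↦ hL.2 ?_⟩
  cases k with
  | zero => exact ExtVanishes.left_zero hf h
  | succ k => exact ExtVanishes.left hf hfg hg h (hN k (by omega))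

theorem IsExtDepth.left {f : L →ₗ[R] M} {g : M →ₗ[R] N} (hf : Function.Injective f)
    (hfg : Function.Exact f g) (hg : Function.Surjective g) {k : ℕ}
    (hN : IsExtDepth R X N k) (hM : ∀ i < k + 1, ExtVanishes R X M i) :
    IsExtDepth R X L (k + 1) := by
  refine ⟨?_, fun h ↦ hN.2 (ExtVanishes.right hf hfg hg (hM k (by omega)) h)⟩
  rintro (_ | i) hi
  · exact ExtVanishes.left_zero hf (hM 0 hi)
  · exact ExtVanishes.left hf hfg hg (hM _ hi) (hN.1 i (by omega))

theorem extVanishes_of_isWeaklyRegular (rs : List R) :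
    ∀ {M : Type u} [AddCommGroup M] [Module R M],
      (∀ r ∈ rs, r ∈ Module.annihilator R X) → RingTheory.Sequence.IsWeaklyRegular M rs →
      ∀ i < rs.length, ExtVanishes R X M i := by
  induction rs with
  | nil => intro M _ _ _ _ i hi; simp at hi
  | cons r rs ih =>
    intro M _ _ hann hreg i hi
    rw [RingTheory.Sequence.isWeaklyRegular_cons_iff] at hreg
    have hr := hann r (by simp)
    cases i with
    | zero => exact extVanishes_zero_of_lsmul hr hreg.1
    | succ i =>
      refine ExtVanishes.succ_of_lsmul (N := QuotSMulTop r M) hr hreg.1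
        (LinearMap.exact_lsmul_mkQ_smul_top M r) (Submodule.mkQ_surjective _) ?_
      exact ih (fun s hs ↦ hann s (by simp [hs])) hreg.2 i (by simpa using hi)

/-- Over a Noetherian ring `Hom(X, M) = 0` produces an `M`-regular element of the annihilator of
`X`; passing to `M/rM` costs one degree of vanishing. -/
theorem exists_isWeaklyRegular_of_extVanishes [IsNoetherianRing R] [Module.Finite R X] (k : ℕ) :
    ∀ {M : Type u} [AddCommGroup M] [Module R M] [Module.Finite R M],
      (∀ i < k, ExtVanishes R X M i) →
      ∃ rs : List R, rs.length = k ∧ (∀ r ∈ rs, r ∈ Module.annihilator R X) ∧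
        RingTheory.Sequence.IsWeaklyRegular M rs := by
  induction k with
  | zero => intro M _ _ _ _; exact ⟨[], rfl, by simp, .nil _ _⟩
  | succ k ih =>
    intro M _ _ _ hv
    obtain ⟨r, hr, hreg⟩ := IsSMulRegular.subsingleton_linearMap_iff.1
      (extVanishes_zero_iff.1 (hv 0 (by omega)))
    obtain ⟨rs, hlen, hann, hrs⟩ := ih (M := QuotSMulTop r M) fun i hi ↦
      ExtVanishes.right (f := LinearMap.lsmul R M r) hreg (LinearMap.exact_lsmul_mkQ_smul_top M r)
        (Submodule.mkQ_surjective _) (hv i (by omega)) (hv (i + 1) (by omega))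
    refine ⟨r :: rs, by simp [hlen], ?_, .cons hreg hrs⟩
    simpa using ⟨hr, hann⟩

end ExtDepth

theorem polyDepth_eq_of_isExtDepth {K : Type*} [Field K] {n : ℕ} {M : Type _} [AddCommGroup M]
    [Module (MvPolynomial (Fin n) K) M] [Module.Finite (MvPolynomial (Fin n) K) M] {k : ℕ}
    (hM : idealOfVars (Fin n) K • (⊤ : Submodule (MvPolynomial (Fin n) K) M) ≠ ⊤)
    (h : IsExtDepth (MvPolynomial (Fin n) K) (MvPolynomial (Fin n) K ⧸ idealOfVars (Fin n) K) M k) :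
    polyDepth K n M = k := by
  have hann : Module.annihilator (MvPolynomial (Fin n) K)
      (MvPolynomial (Fin n) K ⧸ idealOfVars (Fin n) K) = idealOfVars (Fin n) K :=
    Ideal.annihilator_quotient
  apply le_antisymm
  · refine sSup_le ?_
    rintro _ ⟨rs, hrs, hreg, rfl⟩
    by_contra! hlt
    refine h.2 (extVanishes_of_isWeaklyRegular rs ?_ hreg.toIsWeaklyRegular k (by exact_mod_cast hlt))
    rwa [hann]
  · obtain ⟨rs, hlen, hrs, hreg⟩ := exists_isWeaklyRegular_of_extVanishes k h.1
    rw [hann] at hrs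
    -- Regularity also asks that `rs` not generate all of `M`; this holds because `rs` lies in the
    -- ideal of variables.
    refine le_sSup ⟨rs, hrs, ⟨hreg, fun htop ↦ hM ?_⟩, by rw [hlen]⟩
    rw [eq_top_iff]
    nth_rw 1 [htop]
    exact Submodule.smul_mono_left (Ideal.span_le.2 hrs)

/-! ### Exact sequences from colon ideals -/

section ColonIdeal

universe u

variable {R : Type u} [CommRing R] {X : Type u} [AddCommGroup X] [Module R X]

/-- The hypotheses say `J₁ = J : a` and `J₂ = J + (a)`, so `0 → R/J₁ → R/J → R/J₂ → 0` is exact, the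
first map being multiplication by `a`. -/
theorem IsExtDepth.quotient_of_colon {J J₁ J₂ : Ideal R} {a : R} (hcolon : ∀ p, a * p ∈ J ↔ p ∈ J₁)
    (hsup : ∀ p, p ∈ J₂ ↔ ∃ q, p - a * q ∈ J) {k : ℕ} (h₁ : IsExtDepth R X (R ⧸ J₁) k)
    (h₂ : ∀ i < k, ExtVanishes R X (R ⧸ J₂) i) : IsExtDepth R X (R ⧸ J) k := by
  refine IsExtDepth.middle (f := Submodule.mapQ J₁ J (LinearMap.lsmul R R a) fun p hp ↦
      (hcolon p).2 hp)
    (g := Submodule.mapQ J J₂ LinearMap.id fun p hp ↦ (hsup p).2 ⟨0, by simpa using hp⟩)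
    ?_ ?_ ?_ h₁ h₂
  · rw [injective_iff_map_eq_zero]
    intro x hx
    obtain ⟨p, rfl⟩ := Submodule.mkQ_surjective _ x
    exact (Submodule.Quotient.mk_eq_zero _).2 ((hcolon p).1 ((Submodule.Quotient.mk_eq_zero _).1 hx))
  · intro x
    obtain ⟨p, rfl⟩ := Submodule.mkQ_surjective _ x
    simp only [Submodule.mkQ_apply, Submodule.mapQ_apply, Submodule.Quotient.mk_eq_zero,
      LinearMap.id_apply, hsup, Set.mem_range]
    constructor
    · rintro ⟨q, hq⟩
      exact ⟨Submodule.Quotient.mk q, ((Submodule.Quotient.eq _).2 hq).symm⟩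
    · rintro ⟨y, hy⟩
      obtain ⟨q, rfl⟩ := Submodule.mkQ_surjective _ y
      exact ⟨q, (Submodule.Quotient.eq _).1 hy.symm⟩
  · intro x
    obtain ⟨p, rfl⟩ := Submodule.mkQ_surjective _ x
    exact ⟨Submodule.Quotient.mk p, rfl⟩

theorem IsExtDepth.quotient_of_regular {J J₂ : Ideal R} {a : R} (ha : a ∈ Module.annihilator R X)
    (hcolon : ∀ p, a * p ∈ J ↔ p ∈ J)
    (hsup : ∀ p, p ∈ J₂ ↔ ∃ q, p - a * q ∈ J) {k : ℕ} (h₂ : IsExtDepth R X (R ⧸ J₂) k) :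
    IsExtDepth R X (R ⧸ J) (k + 1) := by
  refine IsExtDepth.of_lsmul (r := a)
    (g := Submodule.mapQ J J₂ LinearMap.id fun p hp ↦ (hsup p).2 ⟨0, by simpa using hp⟩)
    ha ?_ ?_ ?_ h₂
  · rw [injective_iff_map_eq_zero]
    intro x hx
    obtain ⟨p, rfl⟩ := Submodule.mkQ_surjective _ x
    exact (Submodule.Quotient.mk_eq_zero _).2 ((hcolon p).1 ((Submodule.Quotient.mk_eq_zero _).1 hx))
  · intro x
    obtain ⟨p, rfl⟩ := Submodule.mkQ_surjective _ x
    simp only [Submodule.mkQ_apply, Submodule.mapQ_apply, Submodule.Quotient.mk_eq_zero,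
      LinearMap.id_apply, hsup, Set.mem_range]
    constructor
    · rintro ⟨q, hq⟩
      exact ⟨Submodule.Quotient.mk q, ((Submodule.Quotient.eq _).2 hq).symm⟩
    · rintro ⟨y, hy⟩
      obtain ⟨q, rfl⟩ := Submodule.mkQ_surjective _ y
      exact ⟨q, (Submodule.Quotient.eq _).1 hy.symm⟩
  · intro x
    obtain ⟨p, rfl⟩ := Submodule.mkQ_surjective _ x
    exact ⟨Submodule.Quotient.mk p, rfl⟩

end ColonIdeal

/-! ### Monomial ideals and the induction on Veronese ideals -/

section MonomialIdeal

variable {K : Type*} [Field K] {n : ℕ}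

/-- The ideal of `K[x₁, …, xₙ]` spanned by the monomials with exponent in `U`. -/
noncomputable def monomialIdeal (K : Type*) [Field K] {n : ℕ} (U : Set (Fin n →₀ ℕ)) :
    Ideal (MvPolynomial (Fin n) K) :=
  Ideal.span ((fun s ↦ monomial s 1) '' U)

theorem mem_monomialIdeal {U : Set (Fin n →₀ ℕ)} (hU : IsUpperSet U) {p : MvPolynomial (Fin n) K} :
    p ∈ monomialIdeal K U ↔ ∀ s, coeff s p ≠ 0 → s ∈ U := by
  rw [monomialIdeal, mem_ideal_span_monomial_image]
  simp only [mem_support_iff]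
  exact forall₂_congr fun s _ ↦ ⟨fun ⟨t, ht, hts⟩ ↦ hU hts ht, fun h ↦ ⟨s, h, le_rfl⟩⟩

theorem X_mul_mem_monomialIdeal {U U₁ : Set (Fin n →₀ ℕ)} (hU : IsUpperSet U)
    (hU₁ : IsUpperSet U₁) {y : Fin n} (h : ∀ s, s + Finsupp.single y 1 ∈ U ↔ s ∈ U₁)
    (p : MvPolynomial (Fin n) K) : X y * p ∈ monomialIdeal K U ↔ p ∈ monomialIdeal K U₁ := by
  rw [mem_monomialIdeal hU, mem_monomialIdeal hU₁]
  constructor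
  · intro hp s hs
    rw [← h]
    apply hp
    rwa [add_comm, coeff_X_mul]
  · intro hp s hs
    rw [coeff_X_mul'] at hs
    split_ifs at hs with hy
    · rw [Finsupp.mem_support_iff] at hy
      have hle : Finsupp.single y 1 ≤ s := by simpa [Nat.one_le_iff_ne_zero] using hy
      have := (h _).2 (hp _ hs)
      rwa [tsub_add_cancel_of_le hle] at this
    · exact absurd rfl hs

theorem mem_monomialIdeal_sup {U U₂ : Set (Fin n →₀ ℕ)} (hU : IsUpperSet U)
    (hU₂ : IsUpperSet U₂) {y : Fin n} (h : ∀ s, s ∈ U₂ ↔ s ∈ U ∨ s y ≠ 0)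
    (p : MvPolynomial (Fin n) K) :
    p ∈ monomialIdeal K U₂ ↔ ∃ q, p - X y * q ∈ monomialIdeal K U := by
  rw [mem_monomialIdeal hU₂]
  simp only [mem_monomialIdeal hU]
  constructor
  · intro hp
    -- Division by `X y`: the remainder consists of the terms of `p` free of `y`.
    refine ⟨p.divMonomial (Finsupp.single y 1), fun s hs ↦ ?_⟩
    have hmod : p - X y * (p.divMonomial (Finsupp.single y 1)) = p.modMonomial (Finsupp.single y 1) :=
      sub_eq_of_eq_add' (divMonomial_add_modMonomial p _).symm
    rw [hmod] at hs
    by_cases hle : Finsupp.single y 1 ≤ s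
    · exact absurd (coeff_modMonomial_of_le p hle) hs
    · rw [coeff_modMonomial_of_not_le p hle] at hs
      refine ((h s).1 (hp s hs)).resolve_right fun hy ↦ hle ?_
      simpa [Nat.one_le_iff_ne_zero] using hy
  · rintro ⟨q, hq⟩ s hs
    rw [h, or_iff_not_imp_right, not_not]
    intro hy
    apply hq
    rw [coeff_sub, coeff_X_mul', if_neg (by simpa using hy), sub_zero]
    exact hs

/-- Exponents of the monomials that lie in `I_{V,d} + (xᵢ : i ∈ G)`, where `I_{V,d}` is the square
free Veronese ideal in the variables from `V`. -/
def veroneseExponents {n : ℕ} (V G : Finset (Fin n)) (d : ℕ) : Set (Fin n →₀ ℕ) :=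
  {s | d ≤ (s.support ∩ V).card ∨ ∃ i ∈ G, s i ≠ 0}

theorem isUpperSet_veroneseExponents (V G : Finset (Fin n)) (d : ℕ) :
    IsUpperSet (veroneseExponents V G d) := by
  rintro s t hst (h | ⟨i, hi, h⟩)
  · exact .inl (h.trans (Finset.card_le_card
      (Finset.inter_subset_inter_right (Finsupp.support_mono hst))))
  · exact .inr ⟨i, hi, fun h0 ↦ h (Nat.le_zero.1 (h0 ▸ hst i))⟩

/-- With `V = ∅` and `d = 1` the ideal is `(xᵢ : i ∈ G)`, and the quotient is a polynomial ring in
`m` variables. Each remaining variable is regular; at the end only the residue field is left, whose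
identity map is a nonzero `Hom`. -/
theorem isExtDepth_coordinate (m : ℕ) : ∀ (G : Finset (Fin n)), m + G.card = n →
    IsExtDepth (MvPolynomial (Fin n) K) (MvPolynomial (Fin n) K ⧸ idealOfVars (Fin n) K)
      (MvPolynomial (Fin n) K ⧸ monomialIdeal K (veroneseExponents ∅ G 1)) m := by
  induction m with
  | zero =>
    intro G hG
    obtain rfl : G = Finset.univ := by
      rw [← Finset.card_eq_iff_eq_univ]; simpa using hG
    have hm : monomialIdeal K (veroneseExponents ∅ (Finset.univ : Finset (Fin n)) 1)
        = idealOfVars (Fin n) K := by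
      ext p
      rw [mem_monomialIdeal (isUpperSet_veroneseExponents _ _ _), idealOfVars, ← Set.image_univ,
        mem_ideal_span_X_image]
      simp [veroneseExponents]
    rw [hm]
    refine ⟨by simp, fun h ↦ ?_⟩
    rw [extVanishes_zero_iff] at h
    have h1 := LinearMap.congr_fun (Subsingleton.elim (LinearMap.id : _ →ₗ[MvPolynomial (Fin n) K]
      (MvPolynomial (Fin n) K ⧸ idealOfVars (Fin n) K)) 0) (Submodule.Quotient.mk 1)
    have h2 : (1 : MvPolynomial (Fin n) K) ∈ idealOfVars (Fin n) K :=
      (Submodule.Quotient.mk_eq_zero _).1 h1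
    rw [← hm, mem_monomialIdeal (isUpperSet_veroneseExponents _ _ _)] at h2
    simpa [veroneseExponents] using h2 0 (by simp)
  | succ m ih =>
    intro G hG
    obtain ⟨y, hy⟩ : ∃ y, y ∉ G := by
      by_contra! h
      rw [← Finset.eq_univ_iff_forall] at h
      simp [h] at hG
    refine IsExtDepth.quotient_of_regular (a := X y) ?_
      (X_mul_mem_monomialIdeal (isUpperSet_veroneseExponents _ _ _)
        (isUpperSet_veroneseExponents _ _ _) ?_)
      (mem_monomialIdeal_sup (isUpperSet_veroneseExponents _ _ _)
        (isUpperSet_veroneseExponents _ _ _) ?_) (ih (insert y G) ?_)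
    · rw [Ideal.annihilator_quotient]
      exact Ideal.subset_span ⟨y, rfl⟩
    · intro s
      have hs : ∀ i ∈ G, (s + Finsupp.single y 1 : Fin n →₀ ℕ) i = s i := fun i hi ↦ by
        have : y ≠ i := fun h ↦ hy (h ▸ hi)
        simp [this]
      have : (∃ i ∈ G, (s + Finsupp.single y 1 : Fin n →₀ ℕ) i ≠ 0) ↔ ∃ i ∈ G, s i ≠ 0 :=
        exists_congr fun i ↦ and_congr_right fun hi ↦ by rw [hs i hi]
      simp only [veroneseExponents, Set.mem_ofPred_eq, this, Finset.inter_empty]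
    · intro s
      simp [veroneseExponents, or_comm]
    · rw [Finset.card_insert_of_notMem hy]; omega

/-- Removing `y` from `V` lowers `d` in the colon ideal and enlarges `G` in the sum; `e` is
unchanged in both. The bound `d ≤ |V| + 1` admits the case where no Veronese monomial exists. -/
theorem isExtDepth_veronese (V : Finset (Fin n)) : ∀ (G : Finset (Fin n)) (d e : ℕ), Disjoint V G →
    1 ≤ d → d ≤ V.card + 1 → e + V.card + G.card + 1 = d + n →
    IsExtDepth (MvPolynomial (Fin n) K) (MvPolynomial (Fin n) K ⧸ idealOfVars (Fin n) K)
      (MvPolynomial (Fin n) K ⧸ monomialIdeal K (veroneseExponents V G d)) e := by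
  induction V using Finset.induction_on with
  | empty =>
    intro G d e _ h1 h2 h3
    obtain rfl : d = 1 := by simp at h2; omega
    exact isExtDepth_coordinate e G (by simp at h3; omega)
  | insert y V hy ih =>
    intro G d e hdisj h1 h2 h3
    rw [Finset.card_insert_of_notMem hy] at h2 h3
    rw [Finset.disjoint_insert_left] at hdisj
    -- For `d = 1` the colon ideal would have `d = 0`, so this case is treated directly: all of `V`
    -- joins `G`.
    obtain rfl | hd1 := h1.eq_or_lt
    · have : veroneseExponents (insert y V) G 1 = veroneseExponents ∅ (insert y V ∪ G) 1 := by
        ext s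
        simp only [veroneseExponents, Finset.one_le_card, Set.mem_ofPred_eq, Finset.Nonempty,
          Finset.mem_inter, Finsupp.mem_support_iff, Finset.mem_union, Finset.notMem_empty]
        grind
      rw [this]
      refine isExtDepth_coordinate e _ ?_
      rw [Finset.card_union_of_disjoint (by simpa using hdisj), Finset.card_insert_of_notMem hy]
      omega
    -- Here `d` exceeds the number of variables in `insert y V`, so only the variables in `G`
    -- contribute.
    obtain h2 | h2 := h2.eq_or_lt
    · have : veroneseExponents (insert y V) G d = veroneseExponents ∅ G 1 := by
        ext s
        have : (s.support ∩ insert y V).card < d := by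
          refine (Finset.card_le_card Finset.inter_subset_right).trans_lt ?_
          rw [Finset.card_insert_of_notMem hy]; omega
        simp [veroneseExponents, this]
      rw [this]
      exact isExtDepth_coordinate e _ (by omega)
    obtain ⟨d, rfl⟩ : ∃ d', d = d' + 1 := ⟨d - 1, by omega⟩
    refine IsExtDepth.quotient_of_colon (a := X y)
      (X_mul_mem_monomialIdeal (isUpperSet_veroneseExponents _ _ _)
        (isUpperSet_veroneseExponents _ _ _) ?_)
      (mem_monomialIdeal_sup (isUpperSet_veroneseExponents _ _ _)
        (isUpperSet_veroneseExponents _ _ _) ?_)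
      (ih G d e hdisj.2 (by omega) (by omega) (by omega))
      (ih (insert y G) (d + 1) e ?_ (by omega) (by omega) ?_).1
    · intro s
      have hG : ∀ i ∈ G, (s + Finsupp.single y 1 : Fin n →₀ ℕ) i = s i := fun i hi ↦ by
        have : y ≠ i := fun h ↦ hdisj.1 (h ▸ hi)
        simp [this]
      have hV : (s + Finsupp.single y 1).support ∩ insert y V = insert y (s.support ∩ V) := by
        ext i
        by_cases hi : y = i
        · simp [hi]
        · simp [Ne.symm hi]
      have : (∃ i ∈ G, (s + Finsupp.single y 1 : Fin n →₀ ℕ) i ≠ 0) ↔ ∃ i ∈ G, s i ≠ 0 :=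
        exists_congr fun i ↦ and_congr_right fun hi ↦ by rw [hG i hi]
      simp only [veroneseExponents, Set.mem_ofPred_eq, this, hV]
      rw [Finset.card_insert_of_notMem (by simp [hy]), Nat.add_le_add_iff_right]
    · intro s
      by_cases hs : s y = 0
      · have : s.support ∩ insert y V = s.support ∩ V := by
          ext i; simp; grind
        simp [veroneseExponents, this, hs]
      · simp [veroneseExponents, hs]
    · simpa [hy] using hdisj.2
    · rw [Finset.card_insert_of_notMem hdisj.1]; omega

/-- The exponent vector of the square free monomial `∏ i ∈ F, X i`. -/
noncomputable def sqfreeExponent (F : Finset (Fin n)) : Fin n →₀ ℕ :=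
  ∑ i ∈ F, Finsupp.single i 1

theorem sqfreeExponent_apply (F : Finset (Fin n)) (i : Fin n) :
    sqfreeExponent F i = if i ∈ F then 1 else 0 := by
  simp [sqfreeExponent, Finsupp.finsetSum_apply, Finsupp.single_apply]

theorem support_sqfreeExponent (F : Finset (Fin n)) : (sqfreeExponent F).support = F := by
  ext i
  simp [sqfreeExponent_apply]

theorem prod_X_eq_monomial (F : Finset (Fin n)) :
    ∏ i ∈ F, (X i : MvPolynomial (Fin n) K) = monomial (sqfreeExponent F) 1 := by
  rw [sqfreeExponent, monomial_sum_one]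
  rfl

theorem sqfreeExponent_le {F : Finset (Fin n)} {s : Fin n →₀ ℕ} (h : F ⊆ s.support) :
    sqfreeExponent F ≤ s := by
  intro i
  rw [sqfreeExponent_apply]
  split_ifs with hi
  · exact Nat.one_le_iff_ne_zero.2 (Finsupp.mem_support_iff.1 (h hi))
  · exact Nat.zero_le _

theorem sqfreeVeronese_eq_monomialIdeal (d : ℕ) :
    sqfreeVeronese K n d = monomialIdeal K (veroneseExponents Finset.univ ∅ d) := by
  apply le_antisymm
  · rw [sqfreeVeronese, Ideal.span_le]
    rintro _ ⟨F, rfl, rfl⟩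
    rw [prod_X_eq_monomial]
    exact Ideal.subset_span ⟨sqfreeExponent F,
      .inl (by simp [support_sqfreeExponent]), rfl⟩
  · rw [monomialIdeal, Ideal.span_le]
    rintro _ ⟨s, hs, rfl⟩
    simp only [veroneseExponents, Finset.inter_univ, Finset.notMem_empty, false_and, exists_false,
      or_false, Set.mem_ofPred_eq] at hs
    obtain ⟨F, hFs, hF⟩ := Finset.exists_subset_card_eq hs
    have : (monomial s 1 : MvPolynomial (Fin n) K)
        = monomial (s - sqfreeExponent F) 1 * ∏ i ∈ F, X i := by
      rw [prod_X_eq_monomial, monomial_mul, tsub_add_cancel_of_le (sqfreeExponent_le hFs), one_mul]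
    simp only [SetLike.mem_coe]
    rw [this]
    exact Ideal.mul_mem_left _ _ (Ideal.subset_span ⟨F, hF, rfl⟩)

theorem mem_sqfreeVeronese {d : ℕ} {p : MvPolynomial (Fin n) K} :
    p ∈ sqfreeVeronese K n d ↔ ∀ s, coeff s p ≠ 0 → d ≤ s.support.card := by
  rw [sqfreeVeronese_eq_monomialIdeal, mem_monomialIdeal (isUpperSet_veroneseExponents _ _ _)]
  simp [veroneseExponents]

end MonomialIdeal

/-! ### Depth of the Veronese ideal and of its quotient -/

section Depth

variable {K : Type*} [Field K] {n d : ℕ}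

theorem mem_idealOfVars_iff_coeff_zero {p : MvPolynomial (Fin n) K} :
    p ∈ idealOfVars (Fin n) K ↔ coeff 0 p = 0 := by
  rw [← pow_one (idealOfVars (Fin n) K), mem_pow_idealOfVars_iff']
  simp [Finsupp.degree_eq_zero_iff]

theorem isExtDepth_quotient_sqfreeVeronese (hd : 1 ≤ d) (hdn : d ≤ n) :
    IsExtDepth (MvPolynomial (Fin n) K) (MvPolynomial (Fin n) K ⧸ idealOfVars (Fin n) K)
      (MvPolynomial (Fin n) K ⧸ sqfreeVeronese K n d) (d - 1) := by
  rw [sqfreeVeronese_eq_monomialIdeal]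
  exact isExtDepth_veronese _ _ _ _ (by simp) hd (by simp; omega) (by simp; omega)

theorem extVanishes_mvPolynomial {i : ℕ} (hi : i < n) :
    ExtVanishes (MvPolynomial (Fin n) K) (MvPolynomial (Fin n) K ⧸ idealOfVars (Fin n) K)
      (MvPolynomial (Fin n) K) i := by
  have hbot : monomialIdeal K (veroneseExponents (∅ : Finset (Fin n)) ∅ 1) = ⊥ := by
    simp [monomialIdeal, veroneseExponents]
  refine ExtVanishes.of_linearEquiv (Submodule.quotEquivOfEqBot _ hbot) ?_
  exact (isExtDepth_coordinate n ∅ (by simp)).1 i hi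

theorem isExtDepth_sqfreeVeronese (hd : 1 ≤ d) (hdn : d ≤ n) :
    IsExtDepth (MvPolynomial (Fin n) K) (MvPolynomial (Fin n) K ⧸ idealOfVars (Fin n) K)
      (sqfreeVeronese K n d) d := by
  have := IsExtDepth.left (f := (sqfreeVeronese K n d).subtype) (g := (sqfreeVeronese K n d).mkQ)
    (Submodule.injective_subtype _) (LinearMap.exact_subtype_mkQ _) (Submodule.mkQ_surjective _)
    (isExtDepth_quotient_sqfreeVeronese hd hdn)
    (fun i hi ↦ extVanishes_mvPolynomial (by omega))
  rwa [Nat.sub_add_cancel hd] at this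

theorem polyDepth_quotient_sqfreeVeronese (hd : 1 ≤ d) (hdn : d ≤ n) :
    polyDepth K n (MvPolynomial (Fin n) K ⧸ sqfreeVeronese K n d) = (d - 1 : ℕ) := by
  refine polyDepth_eq_of_isExtDepth ?_ (isExtDepth_quotient_sqfreeVeronese hd hdn)
  intro htop
  have hle : sqfreeVeronese K n d ≤ idealOfVars (Fin n) K := fun p hp ↦ by
    rw [mem_idealOfVars_iff_coeff_zero]
    by_contra h
    have := mem_sqfreeVeronese.1 hp 0 h
    simp at this
    omega
  have h1 : (Submodule.Quotient.mk 1 : MvPolynomial (Fin n) K ⧸ sqfreeVeronese K n d) ∈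
      idealOfVars (Fin n) K • (⊤ : Submodule (MvPolynomial (Fin n) K) _) := by
    rw [htop]; trivial
  -- The map `S/I → S/(x₁,…,xₙ)` kills this submodule but not the class of `1`.
  have hker : idealOfVars (Fin n) K • (⊤ : Submodule (MvPolynomial (Fin n) K)
      (MvPolynomial (Fin n) K ⧸ sqfreeVeronese K n d)) ≤
      LinearMap.ker (Submodule.mapQ _ (idealOfVars (Fin n) K) LinearMap.id hle) := by
    rw [Submodule.smul_le]
    intro r hr x _
    obtain ⟨p, rfl⟩ := Submodule.mkQ_surjective _ x
    exact (Submodule.Quotient.mk_eq_zero _).2 (Ideal.mul_mem_right _ _ hr)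
  have h2 := (Submodule.Quotient.mk_eq_zero _).1 (hker h1)
  rw [LinearMap.id_apply, mem_idealOfVars_iff_coeff_zero] at h2
  simp at h2

theorem polyDepth_sqfreeVeronese (hd : 1 ≤ d) (hdn : d ≤ n) :
    polyDepth K n (sqfreeVeronese K n d) = d := by
  refine polyDepth_eq_of_isExtDepth ?_ (isExtDepth_sqfreeVeronese hd hdn)
  intro htop
  obtain ⟨F, -, hF⟩ := Finset.exists_subset_card_eq (s := (Finset.univ : Finset (Fin n))) (n := d)
    (by simpa using hdn)
  have hmem : ∏ i ∈ F, X i ∈ sqfreeVeronese K n d := Ideal.subset_span ⟨F, hF, rfl⟩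
  have h1 : (⟨_, hmem⟩ : sqfreeVeronese K n d) ∈
      idealOfVars (Fin n) K • (⊤ : Submodule (MvPolynomial (Fin n) K) _) := by
    rw [htop]; trivial
  -- A generator of degree `d` is not in `(x₁,…,xₙ) I`: a divisor of `x_F` lying in `I` must be
  -- `x_F` itself, which forces a constant cofactor.
  have h2 : ∀ x ∈ idealOfVars (Fin n) K • (⊤ : Submodule (MvPolynomial (Fin n) K)
      (sqfreeVeronese K n d)), coeff (sqfreeExponent F) (x : MvPolynomial (Fin n) K) = 0 := by
    intro x hx
    refine Submodule.smul_induction_on hx ?_ ?_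
    · rintro r hr ⟨p, hp⟩ -
      change coeff (sqfreeExponent F) (r * p) = 0
      rw [coeff_mul]
      refine Finset.sum_eq_zero fun ⟨a, b⟩ hab ↦ ?_
      rw [Finset.HasAntidiagonal.mem_antidiagonal] at hab
      dsimp only at hab ⊢
      by_contra hne
      have hb := mem_sqfreeVeronese.1 hp b (right_ne_zero_of_mul hne)
      have hle : b ≤ sqfreeExponent F := hab ▸ le_add_self
      have hsupp : b.support = F := Finset.eq_of_subset_of_card_le
        (support_sqfreeExponent F ▸ Finsupp.support_mono hle) (hF ▸ hb)
      have hge : sqfreeExponent F ≤ b := sqfreeExponent_le hsupp.ge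
      obtain rfl := le_antisymm hle hge
      obtain rfl : a = 0 := by simpa using hab
      exact left_ne_zero_of_mul hne (mem_idealOfVars_iff_coeff_zero.1 hr)
    · intro x y hx hy
      simp [hx, hy]
  have h3 := h2 _ h1
  simp [prod_X_eq_monomial] at h3

end Depth

/-! ### Krull dimension of the quotient -/

section KrullDim

variable {K : Type*} [Field K] {n d : ℕ}

theorem ringKrullDim_quotient_span_X_le (G : Finset (Fin n)) :
    ringKrullDim (MvPolynomial (Fin n) K ⧸ Ideal.span (X '' (G : Set (Fin n)) : Set (MvPolynomial (Fin n) K)))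
      ≤ (n - G.card : ℕ) := by
  set J := Ideal.span (X '' (G : Set (Fin n)) : Set (MvPolynomial (Fin n) K))
  let f : MvPolynomial {i // i ∉ G} K →ₐ[K] MvPolynomial (Fin n) K ⧸ J :=
    aeval fun i ↦ Ideal.Quotient.mk J (X i.1)
  have hf : Function.Surjective f := by
    rw [← AlgHom.range_eq_top, eq_top_iff]
    intro x _
    obtain ⟨p, rfl⟩ := Ideal.Quotient.mk_surjective x
    induction p using MvPolynomial.induction_on with
    | C a => exact ⟨C a, (aeval_C _ a).trans rfl⟩
    | add p q hp hq => rw [map_add]; exact add_mem (hp trivial) (hq trivial)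
    | mul_X p i hp =>
      rw [map_mul]
      refine mul_mem (hp trivial) ?_
      by_cases hi : i ∈ G
      · rw [Ideal.Quotient.eq_zero_iff_mem.2 (Ideal.subset_span (Set.mem_image_of_mem X (Finset.mem_coe.2 hi)))]
        exact zero_mem _
      · exact ⟨X ⟨i, hi⟩, by simp [f]⟩
  refine (ringKrullDim_le_of_surjective f.toRingHom hf).trans ?_
  rw [MvPolynomial.ringKrullDim_of_isNoetherianRing]
  simp

/-- If `d` variables were outside the prime `P`, their product would be in `I ≤ P`. -/
theorem exists_coordinate_ideal_le_of_sqfreeVeronese_le {P : Ideal (MvPolynomial (Fin n) K)}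
    [hP : P.IsPrime] (h : sqfreeVeronese K n d ≤ P) :
    ∃ G : Finset (Fin n), n - G.card < d ∧ Ideal.span (X '' (G : Set (Fin n))) ≤ P := by
  classical
  refine ⟨Finset.univ.filter fun i ↦ X i ∈ P, ?_, ?_⟩
  · by_contra! hcard
    have hc : d ≤ (({i | X i ∈ P} : Finset (Fin n))ᶜ).card := by
      rw [Finset.card_compl, Fintype.card_fin]; exact hcard
    obtain ⟨F, hF, hFd⟩ := Finset.exists_subset_card_eq hc
    obtain ⟨i, hi, hiP⟩ := (Ideal.IsPrime.prod_mem_iff).1 (h (Ideal.subset_span ⟨F, hFd, rfl⟩))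
    simpa [hiP] using hF hi
  · rw [Ideal.span_le]
    rintro _ ⟨i, hi, rfl⟩
    simpa using hi

theorem ringKrullDim_quotient_sqfreeVeronese_le :
    ringKrullDim (MvPolynomial (Fin n) K ⧸ sqfreeVeronese K n d) ≤ (d - 1 : ℕ) := by
  rw [ringKrullDim_quotient]
  refine iSup_le fun p ↦ ?_
  -- The coordinate ideal below the smallest prime of the chain lies below all of them, so the whole
  -- chain lives over that ideal.
  obtain ⟨G, hG, hle⟩ := exists_coordinate_ideal_le_of_sqfreeVeronese_le (P := p.head.1.asIdeal)
    (SetLike.coe_subset_coe.1 p.head.2)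
  refine le_trans ?_ ((ringKrullDim_quotient_span_X_le (K := K) G).trans
    (by exact_mod_cast Nat.le_sub_one_of_lt hG))
  rw [ringKrullDim_quotient]
  let q : LTSeries (PrimeSpectrum.zeroLocus
      ((Ideal.span (X '' (G : Set (Fin n))) : Ideal (MvPolynomial (Fin n) K)) :
        Set (MvPolynomial (Fin n) K))) :=
    { length := p.length
      toFun := fun i ↦ ⟨(p i).1, SetLike.coe_subset_coe.2 (hle.trans (LTSeries.head_le p i))⟩
      step := fun i ↦ show (p i.castSucc).1 < (p i.succ).1 from p.step i }
  exact Order.LTSeries.length_le_krullDim q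

theorem le_ringKrullDim_quotient_sqfreeVeronese (hd : 1 ≤ d) (hdn : d ≤ n) :
    ((d - 1 : ℕ) : WithBot ℕ∞) ≤ ringKrullDim (MvPolynomial (Fin n) K ⧸ sqfreeVeronese K n d) := by
  -- Only the first `d - 1` variables survive, so every product of `d` distinct variables is killed.
  let f : MvPolynomial (Fin n) K →ₐ[K] MvPolynomial (Fin (d - 1)) K :=
    aeval fun i ↦ if h : i.1 < d - 1 then X ⟨i.1, h⟩ else 0
  have hf : Function.Surjective f := by
    rw [← AlgHom.range_eq_top, eq_top_iff, ← MvPolynomial.adjoin_range_X, Algebra.adjoin_le_iff]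
    rintro _ ⟨i, rfl⟩
    exact ⟨X ⟨i.1, by omega⟩, by simp [f]⟩
  have hI : ∀ p ∈ sqfreeVeronese K n d, f.toRingHom p = 0 := by
    intro p hp
    rw [← RingHom.mem_ker]
    revert hp p
    change sqfreeVeronese K n d ≤ _
    rw [sqfreeVeronese, Ideal.span_le]
    rintro _ ⟨F, hF, rfl⟩
    obtain ⟨i, hi, hid⟩ : ∃ i ∈ F, ¬ i.1 < d - 1 := by
      by_contra! h
      have : F.card ≤ (Finset.range (d - 1)).card :=
        Finset.card_le_card_of_injOn (fun i ↦ i.1) (fun i hi ↦ by simpa using h i hi)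
          (Fin.val_injective.injOn)
      simp at this
      omega
    simp only [SetLike.mem_coe, RingHom.mem_ker, map_prod]
    exact Finset.prod_eq_zero hi (by simp [f, hid])
  have := ringKrullDim_le_of_surjective (Ideal.Quotient.lift _ f.toRingHom hI)
    (Ideal.Quotient.lift_surjective_of_surjective _ hI hf)
  rw [MvPolynomial.ringKrullDim_of_isNoetherianRing] at this
  simpa using this

end KrullDim

/-! ### Stanley decompositions from interval partitions -/

section Sdepth

variable {K : Type*} [Field K] {n d : ℕ}

section General

variable {M : Type*} [AddCommGroup M] [Module K M]
  [Module (MvPolynomial (Fin n) K) M] [IsScalarTower K (MvPolynomial (Fin n) K) M]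

theorem mem_stanleySpace {m x : M} {Z : Finset (Fin n)} :
    x ∈ stanleySpace (K := K) m Z ↔ ∃ p ∈ supported K (Z : Set (Fin n)), p • m = x := by
  simp [stanleySpace]

theorem support_subset_of_mem_supported {Z : Finset (Fin n)} {p : MvPolynomial (Fin n) K}
    (hp : p ∈ supported K (Z : Set (Fin n))) {s : Fin n →₀ ℕ} (hs : coeff s p ≠ 0) :
    s.support ⊆ Z := by
  rw [mem_supported] at hp
  intro i hi
  exact hp (by simpa using (mem_vars_iff_mem_support i).2 ⟨s, mem_support_iff.2 hs, hi⟩)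

theorem support_of_coeff_mul_sqfree_ne_zero {A B : Finset (Fin n)} (hAB : A ⊆ B)
    {p : MvPolynomial (Fin n) K} (hp : p ∈ supported K (B : Set (Fin n))) {s : Fin n →₀ ℕ}
    (hs : coeff s (p * monomial (sqfreeExponent A) 1) ≠ 0) : A ⊆ s.support ∧ s.support ⊆ B := by
  rw [coeff_mul_monomial'] at hs
  split_ifs at hs with hle
  · rw [mul_one] at hs
    have hA : A ⊆ s.support := by
      simpa [support_sqfreeExponent] using Finsupp.support_mono hle
    refine ⟨hA, fun i hi ↦ ?_⟩
    by_cases hiA : i ∈ A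
    · exact hAB hiA
    · refine support_subset_of_mem_supported hp hs ?_
      simpa [sqfreeExponent_apply, hiA] using hi
  · exact absurd rfl hs

/-- A partition of the set of supports of monomials into intervals `[A j, B j]` yields a Stanley
decomposition of a module that embeds `K`-linearly, compatibly with the multiplication of the
generators by monomials, into the polynomial ring. -/
theorem isStanleyDecomposition_of_intervals {𝒢 : (Fin n → ℤ) → Submodule K M} {r : ℕ}
    {A B : Fin r → Finset (Fin n)} (hAB : ∀ j, A j ⊆ B j)
    (huniq : ∀ (F : Finset (Fin n)) (i j : Fin r), A i ⊆ F → F ⊆ B i → A j ⊆ F → F ⊆ B j → i = j)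
    {m : Fin r → M} (hm : ∀ j, ∃ a, m j ∈ 𝒢 a) (φ : M →ₗ[K] MvPolynomial (Fin n) K)
    (hφ : Function.Injective φ)
    (hφm : ∀ j, ∀ p ∈ supported K (B j : Set (Fin n)),
      φ (p • m j) = p * monomial (sqfreeExponent (A j)) 1)
    (hsupp : ∀ x s, coeff s (φ x) ≠ 0 → ∃ j, A j ⊆ s.support ∧ s.support ⊆ B j) :
    IsStanleyDecomposition 𝒢 m B where
  homogeneous := hm
  free j p hp h := by
    have h1 := hφm j p hp
    rw [h, map_zero] at h1
    simpa using h1.symm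
  isInternal := by
    rw [DirectSum.isInternal_submodule_iff_iSupIndep_and_iSup_eq_top]
    have hcoeff : ∀ j, ∀ x ∈ stanleySpace (K := K) (m j) (B j), ∀ s, coeff s (φ x) ≠ 0 →
        A j ⊆ s.support ∧ s.support ⊆ B j := by
      intro j x hx s hs
      obtain ⟨p, hp, rfl⟩ := mem_stanleySpace.1 hx
      rw [hφm j p hp] at hs
      exact support_of_coeff_mul_sqfree_ne_zero (hAB j) hp hs
    constructor
    · intro j
      rw [Submodule.disjoint_def]
      intro x hx hx'
      apply hφ
      rw [map_zero]
      ext s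
      rw [coeff_zero]
      by_contra hs
      have hj := hcoeff j x hx s hs
      -- The exponent `s` belongs to the interval of `j`, so its coefficient vanishes on every other
      -- Stanley space.
      have hle : ⨆ k, ⨆ (_ : k ≠ j), stanleySpace (K := K) (m k) (B k) ≤
          LinearMap.ker (lcoeff K s ∘ₗ φ) := by
        refine iSup₂_le fun k hk y hy ↦ ?_
        rw [LinearMap.mem_ker]
        by_contra hne
        have hk' := hcoeff k y hy s hne
        exact hk (huniq s.support k j hk'.1 hk'.2 hj.1 hj.2)
      exact hs (hle hx')
    · rw [eq_top_iff]
      rintro x -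
      have hmem : φ x ∈ (⨆ j, stanleySpace (K := K) (m j) (B j)).map φ := by
        rw [(φ x).as_sum]
        refine Submodule.sum_mem _ fun s hs ↦ ?_
        rw [mem_support_iff] at hs
        obtain ⟨j, hAs, hsB⟩ := hsupp x s hs
        have hp : monomial (s - sqfreeExponent (A j)) (coeff s (φ x)) ∈
            supported K (B j : Set (Fin n)) := by
          rw [mem_supported, vars_monomial hs]
          exact_mod_cast (Finsupp.support_mono tsub_le_self).trans hsB
        refine ⟨_, Submodule.mem_iSup_of_mem j (mem_stanleySpace.2 ⟨_, hp, rfl⟩), ?_⟩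
        rw [hφm j _ hp, monomial_mul, tsub_add_cancel_of_le (sqfreeExponent_le hAs), mul_one]
      obtain ⟨y, hy, hyx⟩ := hmem
      exact hφ hyx ▸ hy

end General

theorem mem_multidegComponent (s : Fin n →₀ ℕ) :
    monomial s (1 : K) ∈ multidegComponent K n fun i ↦ (s i : ℤ) :=
  Submodule.subset_span ⟨s, fun _ ↦ rfl, rfl⟩

theorem le_sdepth_sqfreeVeronese :
    (d : ℕ∞) ≤ sdepth (idealGrading (sqfreeVeronese K n d)) := by
  classical
  let T : Finset (Finset (Fin n)) := {F | d ≤ F.card}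
  let A : Fin T.card → Finset (Fin n) := fun j ↦ (T.equivFin.symm j).1
  have hA : ∀ j, d ≤ (A j).card := fun j ↦
    (Finset.mem_filter.1 (T.equivFin.symm j).2).2
  have hm : ∀ j, monomial (sqfreeExponent (A j)) 1 ∈ sqfreeVeronese K n d := fun j ↦ by
    rw [mem_sqfreeVeronese]
    intro s hs
    rw [coeff_monomial] at hs
    obtain rfl : sqfreeExponent (A j) = s := by by_contra h; simp [h] at hs
    rw [support_sqfreeExponent]
    exact hA j
  refine le_trans (le_iInf fun j ↦ by exact_mod_cast hA j) (le_sSup ⟨T.card,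
    fun j ↦ ⟨monomial (sqfreeExponent (A j)) 1, hm j⟩, A, ?_, rfl⟩)
  refine isStanleyDecomposition_of_intervals (A := A) (fun j ↦ subset_rfl) ?_
    (fun j ↦ ⟨_, mem_multidegComponent (sqfreeExponent (A j))⟩)
    ((sqfreeVeronese K n d).subtype.restrictScalars K) Subtype.val_injective (fun _ _ _ ↦ rfl) ?_
  · intro F i j h1 h2 h3 h4
    apply T.equivFin.symm.injective
    exact Subtype.ext ((h1.antisymm h2).trans (h3.antisymm h4).symm)
  · intro x s hs
    have h := mem_sqfreeVeronese.1 x.2 s hs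
    refine ⟨T.equivFin ⟨s.support, by simpa [T] using h⟩, ?_⟩
    simp [A]

/-- Freeness fails once `Z` contains `d` variables, because their product annihilates `S/I`. -/
theorem sdepth_quotient_sqfreeVeronese_le (hd : 1 ≤ d) :
    sdepth (quotientGrading (sqfreeVeronese K n d)) ≤ (d - 1 : ℕ) := by
  refine sSup_le ?_
  rintro _ ⟨r, m, Z, hD, rfl⟩
  -- An empty decomposition would have infimum `⊤`; it is excluded because `1 ∉ I`.
  have hne : Nonempty (Fin r) := by
    by_contra hr
    rw [not_nonempty_iff] at hr
    have htop := hD.isInternal.submodule_iSup_eq_top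
    rw [iSup_of_empty] at htop
    have h1 : (Submodule.Quotient.mk 1 : MvPolynomial (Fin n) K ⧸ sqfreeVeronese K n d) ∈
      (⊥ : Submodule K (MvPolynomial (Fin n) K ⧸ sqfreeVeronese K n d)) := htop ▸ trivial
    have := mem_sqfreeVeronese.1 ((Submodule.Quotient.mk_eq_zero _).1 h1) 0 (by simp)
    simp at this
    omega
  obtain ⟨j⟩ := hne
  refine (iInf_le _ j).trans ?_
  by_contra! hlt
  have hZ : d ≤ (Z j).card := by
    have : d - 1 < (Z j).card := by exact_mod_cast hlt
    omega
  obtain ⟨F, hFZ, hF⟩ := Finset.exists_subset_card_eq hZ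
  have h0 : (∏ i ∈ F, X i : MvPolynomial (Fin n) K) = 0 := by
    refine hD.free j _ (Subalgebra.prod_mem _ fun i hi ↦ X_mem_supported.2 (hFZ hi)) ?_
    obtain ⟨p, hp⟩ := Submodule.mkQ_surjective _ (m j)
    rw [← hp]
    exact (Submodule.Quotient.mk_eq_zero _).2
      (Ideal.mul_mem_right _ _ (Ideal.subset_span ⟨F, hF, rfl⟩))
  rw [prod_X_eq_monomial] at h0
  simp at h0

/-- The elements of `B` that are larger than some element outside `B`. -/
noncomputable def restriction (B : Finset (Fin n)) : Finset (Fin n) :=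
  B.filter fun b ↦ ∃ c < b, c ∉ B

/-- Take `b ∈ B \ C` and `c ∈ C \ B`. The larger of the two lies in the restriction of its own set,
hence in `F`, hence in both sets. -/
theorem eq_of_restriction_subset {F B C : Finset (Fin n)} (hcard : B.card = C.card)
    (hB : restriction B ⊆ F) (hFB : F ⊆ B) (hC : restriction C ⊆ F) (hFC : F ⊆ C) : B = C := by
  by_contra hne
  obtain ⟨b, hb, hbC⟩ := Finset.not_subset.1 fun h ↦ hne (Finset.eq_of_subset_of_card_le h hcard.ge)
  obtain ⟨c, hc, hcB⟩ := Finset.not_subset.1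
    fun h ↦ hne (Finset.eq_of_subset_of_card_le h hcard.le).symm
  rcases lt_trichotomy b c with h | rfl | h
  · exact hcB (hFB (hC (Finset.mem_filter.2 ⟨hc, b, h, hbC⟩)))
  · exact hcB hb
  · exact hbC (hFC (hB (Finset.mem_filter.2 ⟨hb, c, h, hcB⟩)))

/-- Fill `F` up with the smallest indices: an added element has nothing missing below it, so it is
not in the restriction. -/
theorem exists_restriction_subset {F : Finset (Fin n)} {k : ℕ} (hF : F.card ≤ k) (hk : k ≤ n) :
    ∃ B : Finset (Fin n), B.card = k ∧ restriction B ⊆ F ∧ F ⊆ B := by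
  obtain ⟨l, hl⟩ : ∃ l, (F ∪ Finset.univ.filter fun i : Fin n ↦ i.1 < l).card = k := by
    have hex : ∃ l, k ≤ (F ∪ Finset.univ.filter fun i : Fin n ↦ i.1 < l).card := by
      refine ⟨n, hk.trans ?_⟩
      rw [Finset.filter_true_of_mem fun i _ ↦ i.2, Finset.union_eq_right.2 (Finset.subset_univ F),
        Finset.card_univ, Fintype.card_fin]
    -- Raising `l` by one adds at most one element, so the first `l` reaching size `k` hits it
    -- exactly.
    refine ⟨Nat.find hex, le_antisymm ?_ (Nat.find_spec hex)⟩
    rcases h : Nat.find hex with _ | l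
    · simpa using hF
    · have hlt := Nat.find_min hex (m := l) (by omega)
      have hsub : (F ∪ Finset.univ.filter fun i : Fin n ↦ i.1 < l + 1).card ≤
          (F ∪ Finset.univ.filter fun i : Fin n ↦ i.1 < l).card + 1 := by
        by_cases hln : l < n
        · refine (Finset.card_le_card (t := insert ⟨l, hln⟩
            (F ∪ Finset.univ.filter fun i : Fin n ↦ i.1 < l)) ?_).trans (Finset.card_insert_le _ _)
          intro i
          simp only [Finset.mem_union, Finset.mem_filter, Finset.mem_univ, true_and,
            Finset.mem_insert, Fin.ext_iff]
          rintro (hi | hi)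
          · exact .inr (.inl hi)
          · exact or_iff_not_imp_left.2 fun h ↦ .inr (by omega)
        · refine (Finset.card_le_card ?_).trans (Nat.le_succ _)
          intro i
          simp only [Finset.mem_union, Finset.mem_filter, Finset.mem_univ, true_and]
          exact Or.imp_right fun _ ↦ by omega
      omega
  refine ⟨_, hl, fun b hb ↦ ?_, Finset.subset_union_left⟩
  simp only [restriction, Finset.mem_filter, Finset.mem_union, Finset.mem_univ, true_and] at hb
  obtain ⟨hb | hb, c, hcb, hc⟩ := hb
  · exact hb
  · exact absurd (.inr (lt_trans hcb hb)) hc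

/-- The projection of the polynomial ring onto the span of the monomials with exponent in `U`. -/
noncomputable def monomialProjection (K : Type*) [Field K] {n : ℕ} (U : Set (Fin n →₀ ℕ)) :
    MvPolynomial (Fin n) K →ₗ[K] MvPolynomial (Fin n) K :=
  open Classical in
  (basisMonomials (Fin n) K).constr K fun s ↦ if s ∈ U then monomial s 1 else 0

theorem coeff_monomialProjection (U : Set (Fin n →₀ ℕ)) (p : MvPolynomial (Fin n) K)
    (s : Fin n →₀ ℕ) [Decidable (s ∈ U)] :
    coeff s (monomialProjection K U p) = if s ∈ U then coeff s p else 0 := by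
  classical
  have : lcoeff K s ∘ₗ monomialProjection K U = if s ∈ U then lcoeff K s else 0 := by
    refine (basisMonomials (Fin n) K).ext fun t ↦ ?_
    rw [LinearMap.comp_apply, monomialProjection, Module.Basis.constr_basis]
    by_cases hst : t = s
    · subst hst; split_ifs <;> simp
    · split_ifs <;> simp [coeff_monomial, hst]
  have h := LinearMap.congr_fun this p
  split_ifs at h ⊢ <;> simpa using h

theorem le_sdepth_quotient_sqfreeVeronese (hd : 1 ≤ d) (hdn : d ≤ n) :
    ((d - 1 : ℕ) : ℕ∞) ≤ sdepth (quotientGrading (sqfreeVeronese K n d)) := by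
  classical
  let T : Finset (Finset (Fin n)) := {F | F.card = d - 1}
  let B : Fin T.card → Finset (Fin n) := fun j ↦ (T.equivFin.symm j).1
  have hB : ∀ j, (B j).card = d - 1 := fun j ↦
    (Finset.mem_filter.1 (T.equivFin.symm j).2).2
  have hRB : ∀ j, restriction (B j) ⊆ B j := fun j ↦ Finset.filter_subset _ _
  let U : Set (Fin n →₀ ℕ) := {s | s.support.card < d}
  let I := sqfreeVeronese K n d
  have hker : I.restrictScalars K = LinearMap.ker (monomialProjection K U) := by
    ext p
    rw [Submodule.restrictScalars_mem, mem_sqfreeVeronese, LinearMap.mem_ker, MvPolynomial.ext_iff]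
    refine forall_congr' fun s ↦ ?_
    rw [coeff_monomialProjection, coeff_zero]
    simp only [U, Set.mem_ofPred_eq, ite_eq_right_iff]
    rw [not_imp_comm, not_le]
  -- This identifies `S/I` with the span of the monomials outside `I`.
  let φ : (MvPolynomial (Fin n) K ⧸ I) →ₗ[K] MvPolynomial (Fin n) K :=
    (Submodule.liftQ _ (monomialProjection K U) hker.le) ∘ₗ
      (Submodule.Quotient.restrictScalarsEquiv K I).symm.toLinearMap
  have hφ : ∀ p, φ (Submodule.Quotient.mk p) = monomialProjection K U p := fun p ↦ rfl
  refine le_trans (le_iInf fun j ↦ by rw [hB j]) (le_sSup ⟨T.card,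
    fun j ↦ Submodule.Quotient.mk (monomial (sqfreeExponent (restriction (B j))) 1), B, ?_, rfl⟩)
  refine isStanleyDecomposition_of_intervals hRB ?_
    (fun j ↦ ⟨_, _, mem_multidegComponent (sqfreeExponent (restriction (B j))), rfl⟩) φ ?_ ?_ ?_
  · intro F i j h1 h2 h3 h4
    apply T.equivFin.symm.injective
    exact Subtype.ext (eq_of_restriction_subset ((hB i).trans (hB j).symm) h1 h2 h3 h4)
  · rw [injective_iff_map_eq_zero]
    intro x hx
    obtain ⟨p, rfl⟩ := Submodule.mkQ_surjective _ x
    have : p ∈ I.restrictScalars K := by rw [hker]; exact hx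
    exact (Submodule.Quotient.mk_eq_zero _).2 this
  -- The monomials of `p * x_{restriction (B j)}` have support in `B j`, of size `d - 1`, so the
  -- projection fixes them.
  · intro j p hp
    rw [← Submodule.Quotient.mk_smul, hφ, smul_eq_mul]
    ext s
    rw [coeff_monomialProjection, ite_eq_left_iff, eq_comm]
    intro hs
    by_contra hne
    have h := Finset.card_le_card (support_of_coeff_mul_sqfree_ne_zero (hRB j) hp hne).2
    rw [hB j] at h
    exact hs (show s.support.card < d by omega)
  · intro x s hs
    obtain ⟨p, rfl⟩ := Submodule.mkQ_surjective _ x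
    have hsU : s ∈ U := by
      by_contra h
      refine hs ?_
      rw [Submodule.mkQ_apply, hφ, coeff_monomialProjection, if_neg h]
    have hsd : s.support.card < d := hsU
    obtain ⟨C, hC, hCs, hsC⟩ := exists_restriction_subset (F := s.support) (k := d - 1) (by omega)
      (by omega)
    refine ⟨T.equivFin ⟨C, by simpa [T] using hC⟩, ?_⟩
    simpa [B] using ⟨hCs, hsC⟩

end Sdepth

theorem corollary1p2 (K : Type*) [Field K] (n d : ℕ) (hd : 1 ≤ d) (hdn : d ≤ n) :
    -- Stanley's conjecture for `S/I` and for `I`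
    polyDepth K n (MvPolynomial (Fin n) K ⧸ sqfreeVeronese K n d)
        ≤ sdepth (quotientGrading (sqfreeVeronese K n d)) ∧
    polyDepth K n (sqfreeVeronese K n d) ≤ sdepth (idealGrading (sqfreeVeronese K n d)) ∧
    -- the depths and the dimension
    polyDepth K n (MvPolynomial (Fin n) K ⧸ sqfreeVeronese K n d) = ((d - 1 : ℕ) : ℕ∞) ∧
    ringKrullDim (MvPolynomial (Fin n) K ⧸ sqfreeVeronese K n d) = ((d - 1 : ℕ) : WithBot ℕ∞) ∧
    polyDepth K n (sqfreeVeronese K n d) = (d : ℕ∞) ∧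
    -- comparison of the two Stanley depths
    sdepth (quotientGrading (sqfreeVeronese K n d)) + 1
      ≤ sdepth (idealGrading (sqfreeVeronese K n d)) := by
  -- The comparison needs the upper bound here as well as the lower one.
  have hSI : sdepth (quotientGrading (sqfreeVeronese K n d)) = ((d - 1 : ℕ) : ℕ∞) :=
    (sdepth_quotient_sqfreeVeronese_le hd).antisymm (le_sdepth_quotient_sqfreeVeronese hd hdn)
  refine ⟨?_, ?_, polyDepth_quotient_sqfreeVeronese hd hdn,
    ringKrullDim_quotient_sqfreeVeronese_le.antisymm
      (le_ringKrullDim_quotient_sqfreeVeronese hd hdn),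
    polyDepth_sqfreeVeronese hd hdn, ?_⟩
  · rw [polyDepth_quotient_sqfreeVeronese hd hdn, hSI]
  · rw [polyDepth_sqfreeVeronese hd hdn]
    exact le_sdepth_sqfreeVeronese
  · rw [hSI]
    refine le_trans (le_of_eq ?_) le_sdepth_sqfreeVeronese
    exact_mod_cast Nat.sub_add_cancel hd
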